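/- For a family of nests $\mathcal C=(\mathcal C_i)_{i\in I}$ (a nest is a non-empty set of subsets of $X$ that is linearly ordered by inclusion; $I\neq\emptyset$) put $S_{\mathcal C}(i)=\bigcap_{j\in I\setminus\{i\}}\bigcap\mathcal C_j$ (which is $X$ if $I=\{i\}$). A topological space $X$ is *independently-based* if for each $x\in X$ there is such a family $\mathcal C$, consisting of nests of neighbourhoods of $x$, for which the sets $\bigcap_{i\in I}C_i$ with $C\in\prod_{i\in I}\mathcal C_i$ form a neighbourhood base at $x$ and $$\bigcap_{i\in I}C_i=\bigcup_{i\in I}\bigl(C_i\cap S_{\mathcal C}(i)\bigr)\qquad\text{for every }C\in\prod_{i\in I}\mathcal C_i .$$ $X$ is *strongly Fréchet* if for every $x\in X$ and every decreasing sequence $(A_n)_{n<\omega}$ of subsets of $X$ with $x\in\bigcap_{n}\overline{A_n}$ there are $x_n\in A_n$ ($n<\omega$) with $x_n\to x$. $X$ is *Fréchet–Urysohn* if, whenever $x\in\overline A$ for some $A\subseteq X$, some sequence in $A$ converges to $x$. **Theorem 4.9.** There exists a Fréchet–Urysohn space that is neither independently-based nor strongly Fréchet. Specifically, for $x\in\mathbb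 R^2\setminus\{\mathbf 0\}$ and $n\in\mathbb N^+$ let $$B_{x,n}=\{y\in\mathbb R^2: |y|<1/n,\ |y-x|=|x|\},$$ where $|\cdot|$ is the Euclidean norm. There is a topology on $\mathbb R^2$ in which every point other than $\mathbf 0$ is isolated and the sets $\bigcup_{x\neq\mathbf 0}B_{x,n_x}$, for all choices of $n_x\in\mathbb N^+$ ($x\in\mathbb R^2\setminus\{\mathbf 0\}$), form a neighbourhood base at $\mathbf 0$; with this (unique) topology, $\mathbb R^2$ is Fréchet–Urysohn, not independently-based and not strongly Fréchet. -/

import Mathlib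

open scoped Topology

universe u v

/-- A nest: a non-empty set (here, of subsets of `X`) linearly ordered by inclusion. -/
def IsNest {X : Type*} (N : Set (Set X)) : Prop :=
  N.Nonempty ∧ IsChain (· ⊆ ·) N

/-- The mesh of a family of nests: all intersections obtained by choosing one member of each
nest. -/
def nestMesh {X I : Type*} (𝒞 : I → Set (Set X)) : Set (Set X) :=
  {M | ∃ C : I → Set X, (∀ i, C i ∈ 𝒞 i) ∧ M = ⋂ i, C i}

/-- The `i`-th spoke of a family of nests: the intersection of all members of all the nests with
index other than `i` (the whole of `X` if `i` is the only index). -/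
def nestSpoke {X I : Type*} (𝒞 : I → Set (Set X)) (i : I) : Set X :=
  ⋂ (j : I) (_ : j ≠ i), ⋂₀ 𝒞 j

/-- A nest system for `x`: a non-empty family of nests of neighbourhoods of `x` whose mesh is a
neighbourhood base for `x`. -/
structure IsNestSystem {X I : Type*} [TopologicalSpace X] (x : X) (𝒞 : I → Set (Set X)) :
    Prop where
  nonempty : Nonempty I
  isNest : ∀ i, IsNest (𝒞 i)
  mem_nhds : ∀ i, ∀ C ∈ 𝒞 i, C ∈ 𝓝 x
  hasBasis_mesh : (𝓝 x).HasBasis (fun M : Set X => M ∈ nestMesh 𝒞) (fun M => M)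

/-- An independent nest system for `x`: every member `⋂ i, C i` of the mesh is the union of its
traces `C i ∩ nestSpoke 𝒞 i`. -/
structure IsIndependentNestSystem {X I : Type*} [TopologicalSpace X] (x : X)
    (𝒞 : I → Set (Set X)) : Prop extends IsNestSystem x 𝒞 where
  independent : ∀ C : I → Set X, (∀ i, C i ∈ 𝒞 i) →
    ⋂ i, C i = ⋃ i, C i ∩ nestSpoke 𝒞 i

/-- Every point has an independent nest system (with an index type in the universe `v`). -/
def IsIndependentlyBased (X : Type u) [TopologicalSpace X] : Prop :=
  ∀ x : X, ∃ (I : Type v) (𝒞 : I → Set (Set X)), IsIndependentNestSystem x 𝒞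

/-- Strongly Fréchet spaces. -/
def IsStronglyFrechet (X : Type*) [TopologicalSpace X] : Prop :=
  ∀ (x : X) (A : ℕ → Set X), Antitone A → x ∈ ⋂ n, closure (A n) →
    ∃ u : ℕ → X, Filter.Tendsto u Filter.atTop (𝓝 x) ∧ ∀ n, u n ∈ A n

/-- The Euclidean plane. -/
abbrev Plane : Type := EuclideanSpace ℝ (Fin 2)

/-- The part, within the open disc of radius `1 / n` around the origin, of the circle with centre
`x` passing through the origin. -/
def circleArc (x : Plane) (n : ℕ+) : Set Plane :=
  Metric.ball 0 ((n : ℝ)⁻¹) ∩ Metric.sphere x ‖x‖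

/-- The union of arcs near the origin, one on the circle around each `x ≠ 0`, where the arc on the
circle around `x` has size given by `n x`. -/
def arcUnion (n : Plane → ℕ+) : Set Plane :=
  ⋃ (x : Plane) (_ : x ≠ 0), circleArc x (n x)

/-! A neighbourhood of the origin may shrink independently along each circle through it. Hence if
the origin is in the closure of a set, one circle already meets that set arbitrarily close to the
origin, which gives Fréchet–Urysohn. Strong Fréchetness fails for the circles centred at `axisCenter
k`: a sequence taken from ever later circles can be avoided along every circle. Suppose an
independent nest system at the origin existed. Near the origin each spoke `i` lies in finitely many
circles, with centres `F i` (`exists_finite_circle_cover`), and by independence a set meeting each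
spoke finitely can be avoided (`IsIndependentNestSystem.compl_mem_nhds`). So each circle has an arc,
of size given by `m x`, that meets spoke `i` off the origin only if `x ∈ F i`. By Baire, some level
set `m = N` is dense near some `x ≠ 0`. The points of the circle around `x` on size-`N` arcs of such
circles meet each spoke finitely, yet accumulate at the origin along the circle around `x`. -/

open Filter Set

/-! ### Nest systems in T₁ spaces -/

section NestSystems

variable {X : Type*} {I : Type*} {𝒞 : I → Set (Set X)}

theorem inter_nestSpoke_subset_iInter {C : I → Set X} (hC : ∀ i, C i ∈ 𝒞 i) (i : I) :
    C i ∩ nestSpoke 𝒞 i ⊆ ⋂ j, C j := by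
  rintro p ⟨hp, hs⟩
  refine mem_iInter.2 fun j => ?_
  by_cases hj : j = i
  · exact hj ▸ hp
  · exact mem_iInter₂.1 hs j hj _ (hC j)

variable [TopologicalSpace X] {x : X}

theorem IsNestSystem.iInter_mem_nhds (h : IsNestSystem x 𝒞) {C : I → Set X}
    (hC : ∀ i, C i ∈ 𝒞 i) : ⋂ i, C i ∈ 𝓝 x :=
  h.hasBasis_mesh.mem_of_mem ⟨C, hC, rfl⟩

/-- On spoke `i` the other nests impose no condition, so one member of nest `i` does the work of a
whole mesh element. -/
theorem IsNestSystem.exists_inter_nestSpoke_subset (h : IsNestSystem x 𝒞) (i : I) {U : Set X}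
    (hU : U ∈ 𝓝 x) : ∃ D ∈ 𝒞 i, D ∩ nestSpoke 𝒞 i ⊆ U := by
  obtain ⟨_, ⟨C, hC, rfl⟩, hsub⟩ := h.hasBasis_mesh.mem_iff.1 hU
  exact ⟨C i, hC i, (inter_nestSpoke_subset_iInter hC i).trans hsub⟩

theorem IsNestSystem.exists_notMem [T1Space X] (h : IsNestSystem x 𝒞) {i : I} {p : X}
    (hp : p ∈ nestSpoke 𝒞 i) (hpx : p ≠ x) : ∃ D ∈ 𝒞 i, p ∉ D := by
  obtain ⟨D, hD, hsub⟩ :=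
    h.exists_inter_nestSpoke_subset i (isOpen_compl_singleton.mem_nhds hpx.symm)
  exact ⟨D, hD, fun hpD => hsub ⟨hpD, hp⟩ rfl⟩

theorem IsNestSystem.eq_of_mem_nestSpoke [T1Space X] (h : IsNestSystem x 𝒞) {i j : I} {p : X}
    (hi : p ∈ nestSpoke 𝒞 i) (hj : p ∈ nestSpoke 𝒞 j) (hpx : p ≠ x) : i = j := by
  by_contra hij
  obtain ⟨D, hD, hpD⟩ := h.exists_notMem hi hpx
  exact hpD (mem_iInter₂.1 hj i hij _ hD)

/-- A set meeting every spoke in a finite set is avoided by a neighbourhood of the point. -/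
theorem IsIndependentNestSystem.compl_mem_nhds [T1Space X] (h : IsIndependentNestSystem x 𝒞)
    {P : Set X} (hxP : x ∉ P) (hfin : ∀ i, (P ∩ nestSpoke 𝒞 i).Finite) : Pᶜ ∈ 𝓝 x := by
  have key : ∀ i, ∃ D ∈ 𝒞 i, D ∩ nestSpoke 𝒞 i ⊆ (P ∩ nestSpoke 𝒞 i)ᶜ := fun i =>
    h.exists_inter_nestSpoke_subset i
      ((hfin i).isClosed.isOpen_compl.mem_nhds fun hx => hxP hx.1)
  choose D hD hsub using key
  refine mem_of_superset (h.iInter_mem_nhds hD) ?_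
  rw [h.independent D hD]
  refine iUnion_subset fun i p hp hpP => hsub i hp ⟨hpP, hp.2⟩

/-- In a Fréchet–Urysohn space, a nest has a countable coinitial part if the point is not isolated
in the corresponding spoke. -/
theorem IsNestSystem.exists_seq_coinitial [T1Space X] [FrechetUrysohnSpace X]
    (h : IsNestSystem x 𝒞) (i : I)
    (hne : ∀ D ∈ 𝒞 i, ∃ p ∈ D ∩ nestSpoke 𝒞 i, p ≠ x) :
    ∃ D : ℕ → Set X, (∀ k, D k ∈ 𝒞 i) ∧ ∀ D' ∈ 𝒞 i, ∀ᶠ k in atTop, D k ⊆ D' := by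
  have hcl : x ∈ closure (nestSpoke 𝒞 i \ {x}) := by
    rw [mem_closure_iff_nhds]
    intro U hU
    obtain ⟨D, hD, hsub⟩ := h.exists_inter_nestSpoke_subset i hU
    obtain ⟨p, hp, hpx⟩ := hne D hD
    exact ⟨p, hsub hp, hp.2, hpx⟩
  obtain ⟨s, hs, hlim⟩ := mem_closure_iff_seq_limit.1 hcl
  choose D hD hsD using fun k => h.exists_notMem (hs k).1 (hs k).2
  refine ⟨D, hD, fun D' hD' => ?_⟩
  -- Eventually `s k` lies in `D'` but never in `D k`, so the chain condition leaves only `D k ⊆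
  -- D'`.
  filter_upwards [hlim (h.mem_nhds i D' hD')] with k hk
  rcases (h.isNest i).2.total (hD k) hD' with hle | hle
  · exact hle
  · exact absurd (hle hk) (hsD k)

end NestSystems

/-- Recursive choice in which each term avoids obstructions created by finitely many earlier terms;
`g n` collects those terms. -/
theorem exists_seq_of_forall_finset {α : Type*} (Q : ℕ → α → Prop) (R : Finset α → α → Prop)
    (hR : ∀ s t : Finset α, s ⊆ t → ∀ a, R t a → R s a)
    (h : ∀ n s, ∃ a, Q n a ∧ R s a) :
    ∃ f : ℕ → α, ∀ n, Q n (f n) ∧ ∀ s : Finset α, (∀ a ∈ s, ∃ k < n, f k = a) → R s (f n) := by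
  classical
  choose c hQ hRc using h
  let g : ℕ → Finset α := fun n => Nat.rec ∅ (fun k s => insert (c k s) s) n
  have hg : ∀ n, g (n + 1) = insert (c n (g n)) (g n) := fun n => rfl
  have hmono : Monotone g := monotone_nat_of_le_succ fun n => by
    rw [hg]; exact Finset.subset_insert _ _
  refine ⟨fun n => c n (g n), fun n => ⟨hQ _ _, fun s hs => hR s (g n) ?_ _ (hRc _ _)⟩⟩
  intro a ha
  obtain ⟨k, hk, rfl⟩ := hs a ha
  exact hmono (Nat.succ_le_of_lt hk) (by rw [hg]; exact Finset.mem_insert_self _ _)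

/-! ### Circles through the origin -/

section Circles

/-- The circle around `x` through the origin. -/
def originCircle (x : Plane) : Set Plane := Metric.sphere x ‖x‖

theorem plane_norm_sq (x : Plane) : ‖x‖ ^ 2 = x 0 ^ 2 + x 1 ^ 2 := by
  rw [EuclideanSpace.norm_sq_eq, Fin.sum_univ_two, Real.norm_eq_abs, Real.norm_eq_abs, sq_abs,
    sq_abs]

theorem plane_ext {x y : Plane} (h0 : x 0 = y 0) (h1 : x 1 = y 1) : x = y := by
  ext i
  fin_cases i
  · exact h0
  · exact h1

theorem mem_originCircle {x y : Plane} :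
    y ∈ originCircle x ↔ y 0 ^ 2 + y 1 ^ 2 = 2 * (x 0 * y 0 + x 1 * y 1) := by
  rw [originCircle, mem_sphere_iff_norm, ← sq_eq_sq₀ (norm_nonneg _) (norm_nonneg _),
    plane_norm_sq, plane_norm_sq]
  simp only [PiLp.sub_apply]
  constructor <;> intro h <;> linarith

theorem zero_mem_originCircle (x : Plane) : (0 : Plane) ∈ originCircle x := by
  simp [mem_originCircle]

theorem circleArc_eq (x : Plane) (n : ℕ+) :
    circleArc x n = {y | ‖y‖ < (n : ℝ)⁻¹ ∧ y ∈ originCircle x} := by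
  ext y
  simp [circleArc, originCircle]

theorem mem_circleArc {x y : Plane} {n : ℕ+} :
    y ∈ circleArc x n ↔ ‖y‖ < (n : ℝ)⁻¹ ∧ y ∈ originCircle x := by
  rw [circleArc_eq]; rfl

theorem circleArc_anti (x : Plane) {m n : ℕ+} (h : m ≤ n) : circleArc x n ⊆ circleArc x m := by
  intro y hy
  rw [mem_circleArc] at hy ⊢
  refine ⟨hy.1.trans_le ?_, hy.2⟩
  have hm : (0 : ℝ) < (m : ℕ) := by exact_mod_cast m.pos
  have hle : ((m : ℕ) : ℝ) ≤ (n : ℕ) := by exact_mod_cast h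
  exact inv_anti₀ hm hle

theorem zero_mem_circleArc (x : Plane) (n : ℕ+) : (0 : Plane) ∈ circleArc x n := by
  rw [mem_circleArc]
  refine ⟨?_, zero_mem_originCircle x⟩
  simp

theorem exists_pnat_inv_lt {ε : ℝ} (hε : 0 < ε) : ∃ n : ℕ+, (n : ℝ)⁻¹ < ε := by
  obtain ⟨n, hn⟩ := exists_nat_one_div_lt hε
  refine ⟨n.succPNat, ?_⟩
  simpa using hn

/-- Subtracting the two circle equations makes `y` orthogonal to `x - z`; that line through the
origin meets a circle in at most one further point. -/
theorem originCircle_inter_subsingleton {x z : Plane} (h : x ≠ z) :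
    ((originCircle x ∩ originCircle z) \ {0}).Subsingleton := by
  have hs : ∀ y ∈ (originCircle x ∩ originCircle z) \ {0},
      let a := x 0 - z 0
      let b := x 1 - z 1
      0 < a ^ 2 + b ^ 2 ∧ y 0 * (a ^ 2 + b ^ 2) = -b * (2 * (x 1 * a - x 0 * b)) ∧
        y 1 * (a ^ 2 + b ^ 2) = a * (2 * (x 1 * a - x 0 * b)) := by
    rintro y ⟨⟨hx, hz⟩, hy0⟩
    rw [mem_originCircle] at hx hz
    intro a b
    have hlin : a * y 0 + b * y 1 = 0 := by simp only [a, b]; linarith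
    have hpos : 0 < a ^ 2 + b ^ 2 := by
      by_contra hcon
      have ha : a = 0 := by nlinarith [sq_nonneg a, sq_nonneg b]
      have hb : b = 0 := by nlinarith [sq_nonneg a, sq_nonneg b]
      exact h (plane_ext (sub_eq_zero.1 ha) (sub_eq_zero.1 hb))
    have h0 : y 0 * (a ^ 2 + b ^ 2) = -b * (a * y 1 - b * y 0) := by
      linear_combination a * hlin
    have h1 : y 1 * (a ^ 2 + b ^ 2) = a * (a * y 1 - b * y 0) := by
      linear_combination b * hlin
    have hs0 : a * y 1 - b * y 0 ≠ 0 := by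
      intro h'
      rw [h', mul_zero] at h0 h1
      exact hy0 (plane_ext ((mul_eq_zero.1 h0).resolve_right hpos.ne')
        ((mul_eq_zero.1 h1).resolve_right hpos.ne'))
    have hs1 : a * y 1 - b * y 0 = 2 * (x 1 * a - x 0 * b) := by
      refine mul_right_cancel₀ hs0 ?_
      linear_combination (a ^ 2 + b ^ 2) * hx - (a * y 0 + b * y 1) * hlin
        + 2 * x 0 * h0 + 2 * x 1 * h1
    exact ⟨hpos, by rw [h0, hs1], by rw [h1, hs1]⟩
  intro p hp q hq
  obtain ⟨hpos, p0, p1⟩ := hs p hp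
  obtain ⟨-, q0, q1⟩ := hs q hq
  exact plane_ext (mul_right_cancel₀ hpos.ne' (p0.trans q0.symm))
    (mul_right_cancel₀ hpos.ne' (p1.trans q1.symm))

/-- Only one circle through the origin passes through two given other points. -/
theorem originCircle_center_unique {p q : Plane} (hp : p ≠ 0) (hq : q ≠ 0) (hpq : p ≠ q) :
    {x | p ∈ originCircle x ∧ q ∈ originCircle x}.Subsingleton := by
  rintro x ⟨hpx, hqx⟩ z ⟨hpz, hqz⟩
  by_contra hxz
  exact hpq (originCircle_inter_subsingleton hxz ⟨⟨hpx, hpz⟩, hp⟩ ⟨⟨hqx, hqz⟩, hq⟩)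

/-- Twice the signed area of the triangle with vertices `0`, `x` and `y`. -/
def crossProd (x y : Plane) : ℝ := x 0 * y 1 - x 1 * y 0

/-- The second intersection point of two non-tangent circles through the origin. -/
theorem exists_mem_originCircle_inter {x y : Plane} (h : crossProd x y ≠ 0) :
    ∃ p : Plane, p ≠ 0 ∧ p ∈ originCircle x ∧ p ∈ originCircle y ∧
      ‖p‖ * ‖y - x‖ = 2 * |crossProd x y| := by
  have hpos : 0 < (y 0 - x 0) ^ 2 + (y 1 - x 1) ^ 2 := by
    by_contra hcon
    have ha : y 0 - x 0 = 0 := by nlinarith [sq_nonneg (y 0 - x 0), sq_nonneg (y 1 - x 1)]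
    have hb : y 1 - x 1 = 0 := by nlinarith [sq_nonneg (y 0 - x 0), sq_nonneg (y 1 - x 1)]
    apply h
    rw [crossProd, sub_eq_zero.1 ha, sub_eq_zero.1 hb]
    ring
  set N := (y 0 - x 0) ^ 2 + (y 1 - x 1) ^ 2 with hN
  have hne := hpos.ne'
  -- The reflection of the origin in the line through `x` and `y`.
  let p : Plane := !₂[2 * crossProd x y * (y 1 - x 1) / N, -(2 * crossProd x y * (y 0 - x 0) / N)]
  have p0 : p 0 = 2 * crossProd x y * (y 1 - x 1) / N := rfl
  have p1 : p 1 = -(2 * crossProd x y * (y 0 - x 0) / N) := rfl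
  have hsq : p 0 ^ 2 + p 1 ^ 2 = 4 * crossProd x y ^ 2 / N := by
    rw [p0, p1]
    field_simp
    rw [hN]
    ring
  refine ⟨p, ?_, ?_, ?_, ?_⟩
  · intro hp
    have hz : p 0 ^ 2 + p 1 ^ 2 = 0 := by rw [hp]; simp
    have hq : 0 < 4 * crossProd x y ^ 2 / N := by positivity
    linarith
  · rw [mem_originCircle, hsq, p0, p1]
    field_simp
    rw [crossProd]
    ring
  · rw [mem_originCircle, hsq, p0, p1]
    field_simp
    rw [crossProd]
    ring
  · rw [← sq_eq_sq₀ (by positivity) (by positivity), mul_pow, mul_pow, sq_abs, plane_norm_sq,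
      plane_norm_sq, hsq]
    simp only [PiLp.sub_apply]
    rw [← hN]
    field_simp
    norm_num

/-- Centres of circles that meet the circle around `x` close to, but not only at, the origin are
found arbitrarily close to `x`. -/
theorem exists_direction {x : Plane} (hx : x ≠ 0) {r : ℝ} (hr : 0 < r) :
    ∃ v : Plane, ∀ ε : ℝ, 0 < ε →
      crossProd x (x + ε • v) ≠ 0 ∧ 2 * |crossProd x (x + ε • v)| < r * ‖(x + ε • v) - x‖ := by
  have hx' : 0 < ‖x‖ := norm_pos_iff.2 hx
  have hxs := plane_norm_sq x
  set δ : ℝ := r / (4 * ‖x‖) with hδ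
  have hδpos : 0 < δ := by positivity
  -- Almost radial: the tilt `δ` makes the cross product nonzero, and `2 * δ * ‖x‖ = r / 2` keeps
  -- the second intersection within `r`.
  let v : Plane := !₂[x 0 - δ * x 1, x 1 + δ * x 0]
  have v0 : v 0 = x 0 - δ * x 1 := rfl
  have v1 : v 1 = x 1 + δ * x 0 := rfl
  have hv : ‖x‖ ≤ ‖v‖ := by
    rw [← sq_le_sq₀ (norm_nonneg _) (norm_nonneg _), plane_norm_sq v, hxs, v0, v1]
    nlinarith [sq_nonneg (δ * x 0), sq_nonneg (δ * x 1)]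
  refine ⟨v, fun ε hε => ?_⟩
  have hc : crossProd x (x + ε • v) = ε * δ * ‖x‖ ^ 2 := by
    rw [hxs, crossProd]
    simp only [PiLp.add_apply, PiLp.smul_apply, smul_eq_mul, v0, v1]
    ring
  have hcpos : 0 < crossProd x (x + ε • v) := by rw [hc]; positivity
  refine ⟨hcpos.ne', ?_⟩
  rw [abs_of_pos hcpos, hc, add_sub_cancel_left, norm_smul, Real.norm_eq_abs, abs_of_pos hε]
  have h1 : 2 * (ε * δ * ‖x‖ ^ 2) = (ε * r / 2) * ‖x‖ := by
    rw [hδ]; field_simp; ring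
  rw [h1]
  have h2 : 0 < ε * r := by positivity
  nlinarith

theorem exists_ne_zero_mem_circleArc {x : Plane} (hx : x ≠ 0) (n : ℕ+) :
    ∃ p ∈ circleArc x n, p ≠ 0 := by
  have hn : (0 : ℝ) < (n : ℝ)⁻¹ := by
    have : (0 : ℝ) < (n : ℕ) := by exact_mod_cast n.pos
    positivity
  obtain ⟨v, hv⟩ := exists_direction hx hn
  obtain ⟨h1, h2⟩ := hv 1 one_pos
  obtain ⟨p, hp0, hpx, -, hnorm⟩ := exists_mem_originCircle_inter h1
  refine ⟨p, mem_circleArc.2 ⟨?_, hpx⟩, hp0⟩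
  rw [← hnorm] at h2
  exact lt_of_mul_lt_mul_right h2 (norm_nonneg _)

end Circles

/-! ### The topology of arcs at the origin -/

section ArcTopology

/-- The filter of sets that contain an arc around the origin of every circle through it. -/
def arcFilter : Filter Plane where
  sets := {s | ∀ x : Plane, x ≠ 0 → ∃ n : ℕ+, circleArc x n ⊆ s}
  univ_sets := fun _ _ => ⟨1, subset_univ _⟩
  sets_of_superset := fun hs hst x hx => (hs x hx).imp fun _ h => h.trans hst
  inter_sets := fun hs ht x hx => by
    obtain ⟨m, hm⟩ := hs x hx
    obtain ⟨n, hn⟩ := ht x hx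
    exact ⟨max m n, subset_inter ((circleArc_anti x (le_max_left _ _)).trans hm)
      ((circleArc_anti x (le_max_right _ _)).trans hn)⟩

theorem mem_arcFilter {s : Set Plane} :
    s ∈ arcFilter ↔ ∀ x : Plane, x ≠ 0 → ∃ n : ℕ+, circleArc x n ⊆ s := Iff.rfl

theorem zero_mem_of_mem_arcFilter {s : Set Plane} (hs : s ∈ arcFilter) : (0 : Plane) ∈ s := by
  obtain ⟨x, hx⟩ := exists_ne (0 : Plane)
  obtain ⟨n, hn⟩ := hs x hx
  exact hn (zero_mem_circleArc x n)

/-- The topology in which all points other than the origin are isolated and the neighbourhoods of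
the origin are the members of `arcFilter`. -/
@[reducible] def arcTopology : TopologicalSpace Plane := nhdsAdjoint 0 arcFilter

theorem nhds_arcTopology_zero : @nhds Plane arcTopology 0 = arcFilter := by
  rw [arcTopology, nhds_nhdsAdjoint_same]
  refine sup_eq_right.2 fun s hs => zero_mem_of_mem_arcFilter hs

theorem nhds_arcTopology_of_ne {p : Plane} (hp : p ≠ 0) : @nhds Plane arcTopology p = pure p :=
  nhds_nhdsAdjoint_of_ne _ hp

theorem compl_mem_arcFilter {Q : Set Plane} (h0 : (0 : Plane) ∉ Q)
    (hfin : ∀ x, x ≠ 0 → (Q ∩ originCircle x).Finite) : Qᶜ ∈ arcFilter := by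
  intro x hx
  have hmem : (Q ∩ originCircle x)ᶜ ∈ 𝓝 (0 : Plane) :=
    (hfin x hx).isClosed.isOpen_compl.mem_nhds fun h => h0 h.1
  obtain ⟨ε, hε, hball⟩ := Metric.mem_nhds_iff.1 hmem
  obtain ⟨n, hn⟩ := exists_pnat_inv_lt hε
  refine ⟨n, fun p hp hpQ => ?_⟩
  rw [mem_circleArc] at hp
  exact hball (by simpa using hp.1.trans hn) ⟨hpQ, hp.2⟩

theorem t1Space_arcTopology : @T1Space Plane arcTopology := by
  refine @T1Space.mk Plane arcTopology fun p => ?_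
  rw [← @isOpen_compl_iff Plane _ arcTopology, @isOpen_iff_mem_nhds Plane arcTopology]
  intro q hq
  by_cases hq0 : q = 0
  · subst hq0
    rw [nhds_arcTopology_zero]
    exact compl_mem_arcFilter hq fun x _ => (finite_singleton p).inter_of_left _
  · rw [nhds_arcTopology_of_ne hq0]
    exact hq

theorem hasBasis_arcTopology :
    (@nhds Plane arcTopology 0).HasBasis (fun _ : Plane → ℕ+ => True) arcUnion := by
  rw [nhds_arcTopology_zero]
  refine ⟨fun s => ⟨fun hs => ?_, ?_⟩⟩
  · have : ∀ x : Plane, ∃ n : ℕ+, x ≠ 0 → circleArc x n ⊆ s := fun x => by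
      by_cases hx : x = 0
      · exact ⟨1, fun h => absurd hx h⟩
      · exact (hs x hx).imp fun _ h _ => h
    choose n hn using this
    exact ⟨n, trivial, iUnion₂_subset hn⟩
  · rintro ⟨n, -, hn⟩ x hx
    exact ⟨n x, (subset_iUnion₂ (s := fun (x : Plane) (_ : x ≠ 0) => circleArc x (n x)) x hx).trans
      hn⟩

theorem frechetUrysohnSpace_arcTopology : @FrechetUrysohnSpace Plane arcTopology := by
  refine @FrechetUrysohnSpace.mk Plane arcTopology fun A p hp => ?_
  by_cases hpA : p ∈ A
  · exact @subset_seqClosure Plane arcTopology A p hpA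
  have hp0 : p = 0 := by
    by_contra hp0
    obtain ⟨q, hq, hqA⟩ := (@mem_closure_iff_nhds Plane arcTopology _ _).1 hp {p}
      (by rw [nhds_arcTopology_of_ne hp0]; exact mem_singleton p)
    exact hpA (mem_singleton_iff.1 hq ▸ hqA)
  subst hp0
  have hx : ∃ x : Plane, x ≠ 0 ∧ ∀ n : ℕ+, (circleArc x n ∩ A).Nonempty := by
    by_contra! hcon
    have hA : Aᶜ ∈ arcFilter := fun x hx => by
      obtain ⟨n, hn⟩ := hcon x hx
      exact ⟨n, fun q hq hqA => (hn ▸ (⟨hq, hqA⟩ : q ∈ circleArc x n ∩ A) : q ∈ (∅ : Set Plane))⟩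
    rw [← nhds_arcTopology_zero] at hA
    obtain ⟨q, hq, hqA⟩ := (@mem_closure_iff_nhds Plane arcTopology _ _).1 hp _ hA
    exact hq hqA
  obtain ⟨x, hx0, hx⟩ := hx
  choose u hu using fun k : ℕ => hx k.succPNat
  refine ⟨u, fun k => (hu k).2, ?_⟩
  rw [nhds_arcTopology_zero]
  intro s hs
  obtain ⟨n, hn⟩ := hs x hx0
  refine mem_map.2 ((eventually_ge_atTop (n : ℕ)).mono fun k hk => ?_)
  refine hn (circleArc_anti x ?_ (hu k).1)
  rw [← PNat.coe_le_coe]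
  exact hk.trans (Nat.le_succ k)

end ArcTopology

/-! ### No independent nest system at the origin -/

section NotIndependentlyBased

variable {I : Type*} {𝒞 : I → Set (Set Plane)}

theorem finite_setOf_mem_originCircle (s : Finset Plane) :
    {x | ∃ a ∈ s, ∃ b ∈ s, a ≠ 0 ∧ b ≠ 0 ∧ a ≠ b ∧ a ∈ originCircle x ∧ b ∈ originCircle x}.Finite := by
  have : {x | ∃ a ∈ s, ∃ b ∈ s, a ≠ 0 ∧ b ≠ 0 ∧ a ≠ b ∧ a ∈ originCircle x ∧ b ∈ originCircle x} ⊆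
      ⋃ a ∈ s, ⋃ b ∈ s,
        {x | a ≠ 0 ∧ b ≠ 0 ∧ a ≠ b ∧ a ∈ originCircle x ∧ b ∈ originCircle x} := by
    rintro x ⟨a, ha, b, hb, h⟩
    simp only [mem_iUnion]
    exact ⟨a, ha, b, hb, h⟩
  refine Set.Finite.subset ?_ this
  refine s.finite_toSet.biUnion fun a _ => s.finite_toSet.biUnion fun b _ =>
    Set.Subsingleton.finite ?_
  rintro x ⟨ha, hb, hab, hax, hbx⟩ y ⟨-, -, -, hay, hby⟩
  exact originCircle_center_unique ha hb hab ⟨hax, hbx⟩ ⟨hay, hby⟩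

/-- Near the origin, every spoke is covered by finitely many circles. -/
theorem exists_finite_circle_cover (h : @IsIndependentNestSystem Plane I arcTopology 0 𝒞) (i : I) :
    ∃ D ∈ 𝒞 i, ∃ F : Set Plane, F.Finite ∧
      ∀ p ∈ D ∩ nestSpoke 𝒞 i, p ≠ 0 → ∃ x ∈ F, p ∈ originCircle x := by
  by_contra! hcon
  have hns := @IsIndependentNestSystem.toIsNestSystem Plane I arcTopology 0 𝒞 h
  obtain ⟨D, hD, hco⟩ := @IsNestSystem.exists_seq_coinitial Plane I 𝒞 arcTopology 0
    t1Space_arcTopology frechetUrysohnSpace_arcTopology hns i (fun D hD => by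
      obtain ⟨p, hp, hp0, -⟩ := hcon D hD ∅ finite_empty
      exact ⟨p, hp, hp0⟩)
  -- Each `y n` avoids every circle through two distinct earlier values, so every circle meets the
  -- range finitely.
  obtain ⟨y, hy⟩ := exists_seq_of_forall_finset
    (fun n p => p ∈ D n ∩ nestSpoke 𝒞 i ∧ p ≠ 0)
    (fun s p => ∀ x, (∃ a ∈ s, ∃ b ∈ s, a ≠ 0 ∧ b ≠ 0 ∧ a ≠ b ∧ a ∈ originCircle x ∧
      b ∈ originCircle x) → p ∉ originCircle x)
    (fun s t hst p hp x ⟨a, ha, b, hb, hx⟩ => hp x ⟨a, hst ha, b, hst hb, hx⟩)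
    (fun n s => by
      obtain ⟨p, hp, hp0, hpx⟩ := hcon (D n) (hD n) _ (finite_setOf_mem_originCircle s)
      exact ⟨p, ⟨hp, hp0⟩, hpx⟩)
  have hthird : ∀ x a b c, a < b → b < c → y a ≠ y b → y a ∈ originCircle x →
      y b ∈ originCircle x → y c ∉ originCircle x := by
    classical
    intro x a b c hab hbc hne ha hb
    refine (hy c).2 {y a, y b} ?_ x ⟨y a, by simp, y b, by simp, (hy a).1.2, (hy b).1.2, hne, ha, hb⟩
    intro p hp
    simp only [Finset.mem_insert, Finset.mem_singleton] at hp
    rcases hp with rfl | rfl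
    · exact ⟨a, hab.trans hbc, rfl⟩
    · exact ⟨b, hbc, rfl⟩
  have hcompl : (range y)ᶜ ∈ arcFilter := by
    refine compl_mem_arcFilter ?_ fun x _ => ?_
    · rintro ⟨k, hk⟩
      exact (hy k).1.2 hk
    · by_cases hpair : ∃ a b, a < b ∧ y a ≠ y b ∧ y a ∈ originCircle x ∧ y b ∈ originCircle x
      · obtain ⟨a, b, hab, hne, ha, hb⟩ := hpair
        refine ((finite_Iic b).image y).subset ?_
        rintro _ ⟨⟨c, rfl⟩, hc⟩
        refine mem_image_of_mem y (mem_Iic.2 (not_lt.1 fun hbc => ?_))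
        exact hthird x a b c hab hbc hne ha hb hc
      · push Not at hpair
        refine Set.Subsingleton.finite ?_
        rintro _ ⟨⟨a, rfl⟩, ha⟩ _ ⟨⟨b, rfl⟩, hb⟩
        by_contra hne
        rcases lt_trichotomy a b with hab | hab | hab
        · exact hpair a b hab hne ha hb
        · exact hne (congrArg y hab)
        · exact hpair b a hab (Ne.symm hne) hb ha
  rw [← nhds_arcTopology_zero] at hcompl
  obtain ⟨D', hD', hsub⟩ :=
    @IsNestSystem.exists_inter_nestSpoke_subset Plane I 𝒞 arcTopology 0 hns i _ hcompl
  obtain ⟨k, hk⟩ := (hco D' hD').exists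
  exact hsub ⟨hk (hy k).1.1.1, (hy k).1.1.2⟩ (mem_range_self k)

theorem finite_inter_originCircles {F : Set Plane} (hF : F.Finite) (x : Plane) :
    {p | p ≠ 0 ∧ p ∈ originCircle x ∧ ∃ z ∈ F, z ≠ x ∧ p ∈ originCircle z}.Finite := by
  have hsub : {p | p ≠ 0 ∧ p ∈ originCircle x ∧ ∃ z ∈ F, z ≠ x ∧ p ∈ originCircle z} ⊆
      ⋃ z ∈ F, {p | z ≠ x ∧ p ∈ (originCircle z ∩ originCircle x) \ {0}} := by
    rintro p ⟨hp0, hpx, z, hz, hzx, hpz⟩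
    simp only [mem_iUnion]
    exact ⟨z, hz, hzx, ⟨hpz, hpx⟩, hp0⟩
  refine (hF.biUnion fun z _ => Set.Subsingleton.finite ?_).subset hsub
  rintro p ⟨hzx, hp⟩ q ⟨-, hq⟩
  exact originCircle_inter_subsingleton hzx hp hq

theorem not_isIndependentNestSystem_arcTopology :
    ¬ @IsIndependentNestSystem Plane I arcTopology 0 𝒞 := by
  intro h
  have hns := @IsIndependentNestSystem.toIsNestSystem Plane I arcTopology 0 𝒞 h
  have hcompl : ∀ P : Set Plane, (0 : Plane) ∉ P → (∀ i, (P ∩ nestSpoke 𝒞 i).Finite) →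
      Pᶜ ∈ arcFilter := fun P h0 hfin => by
    rw [← nhds_arcTopology_zero]
    exact @IsIndependentNestSystem.compl_mem_nhds Plane I 𝒞 arcTopology 0 t1Space_arcTopology h P
      h0 hfin
  choose D hD F hF hcov using exists_finite_circle_cover h
  have hM : ⋂ i, D i ∈ arcFilter := by
    rw [← nhds_arcTopology_zero]
    exact @IsNestSystem.iInter_mem_nhds Plane I 𝒞 arcTopology 0 hns D hD
  have harc : ∀ x : Plane, ∃ m : ℕ+, x ≠ 0 →
      ∀ p ∈ circleArc x m, p ≠ 0 → ∀ i, p ∈ nestSpoke 𝒞 i → x ∈ F i := by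
    intro x
    by_cases hx : x = 0
    · exact ⟨1, fun h => absurd hx h⟩
    -- On spoke `i`, a point of `T` lies on a circle with centre in `F i` other than `x`, so only
    -- finitely many occur.
    let T : Set Plane := {p | p ≠ 0 ∧ p ∈ originCircle x ∧ p ∈ ⋂ i, D i ∧
      ∃ i, p ∈ nestSpoke 𝒞 i ∧ x ∉ F i}
    have hT : Tᶜ ∈ arcFilter := by
      refine hcompl T (fun h0 => h0.1 rfl) fun i => ?_
      refine (finite_inter_originCircles (hF i) x).subset ?_
      rintro p ⟨⟨hp0, hpx, hpD, j, hpj, hxj⟩, hpi⟩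
      obtain rfl : j = i := @IsNestSystem.eq_of_mem_nestSpoke Plane I 𝒞 arcTopology 0
        t1Space_arcTopology hns j i p hpj hpi hp0
      obtain ⟨z, hz, hpz⟩ := hcov j p ⟨mem_iInter.1 hpD j, hpj⟩ hp0
      exact ⟨hp0, hpx, z, hz, fun hzx => hxj (hzx ▸ hz), hpz⟩
    obtain ⟨m, hm⟩ := inter_mem hM hT x hx
    refine ⟨m, fun _ p hp hp0 i hpi => ?_⟩
    by_contra hxi
    exact (hm hp).2 ⟨hp0, (mem_circleArc.1 hp).2, (hm hp).1, i, hpi, hxi⟩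
  choose m hm using harc
  obtain ⟨N, hN⟩ := nonempty_interior_of_iUnion_of_closed
    (f := fun N : ℕ+ => closure {y : Plane | m y = N}) (fun _ => isClosed_closure)
    (eq_univ_of_forall fun y => mem_iUnion.2 ⟨m y, subset_closure rfl⟩)
  obtain ⟨x, hxU, hx0⟩ :=
    (dense_compl_singleton (0 : Plane)).inter_open_nonempty _ isOpen_interior hN
  let P : Set Plane := {p | p ≠ 0 ∧ p ∈ originCircle x ∧
    ∃ y, y ≠ 0 ∧ y ≠ x ∧ m y = N ∧ p ∈ circleArc y N}
  have hP : Pᶜ ∈ arcFilter := by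
    refine hcompl P (fun h0 => h0.1 rfl) fun i => ?_
    refine (finite_inter_originCircles (hF i) x).subset ?_
    rintro p ⟨⟨hp0, hpx, y, hy0, hyx, hyN, hpy⟩, hpi⟩
    exact ⟨hp0, hpx, y, hm y hy0 p (hyN ▸ hpy) hp0 i hpi, hyx, (mem_circleArc.1 hpy).2⟩
  obtain ⟨n, hn⟩ := hP x hx0
  set r : ℝ := min (n : ℝ)⁻¹ (N : ℝ)⁻¹ with hr
  have hr0 : 0 < r := by
    have h1 : (0 : ℝ) < (n : ℕ) := by exact_mod_cast n.pos
    have h2 : (0 : ℝ) < (N : ℕ) := by exact_mod_cast N.pos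
    exact lt_min (inv_pos.2 h1) (inv_pos.2 h2)
  obtain ⟨v, hv⟩ := exists_direction hx0 hr0
  have hcross : Continuous fun y : Plane => crossProd x y := by
    unfold crossProd
    fun_prop
  have hV : IsOpen {y : Plane | crossProd x y ≠ 0 ∧ 2 * |crossProd x y| < r * ‖y - x‖} :=
    (isOpen_ne_fun hcross continuous_const).inter
      (isOpen_lt (continuous_const.mul hcross.abs)
        (continuous_const.mul (continuous_id.sub continuous_const).norm))
  have hev : ∀ᶠ ε : ℝ in 𝓝[>] 0, x + ε • v ∈ interior (closure {y : Plane | m y = N}) := by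
    have hc : Continuous fun ε : ℝ => x + ε • v := by fun_prop
    refine (hc.tendsto 0).mono_left nhdsWithin_le_nhds (isOpen_interior.mem_nhds ?_)
    simpa using hxU
  obtain ⟨ε, hεU, hε⟩ := (hev.and self_mem_nhdsWithin).exists
  -- The centre `x + ε • v` need not satisfy `m = N`, but the inequalities are open, so a nearby
  -- centre in the level set serves.
  obtain ⟨y, ⟨hyU, hyc, hyr⟩, hyN⟩ := mem_closure_iff.1 (interior_subset hεU) _
    (isOpen_interior.inter hV) ⟨hεU, hv ε hε⟩
  obtain ⟨p, hp0, hpx, hpy, hnorm⟩ := exists_mem_originCircle_inter hyc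
  have hpr : ‖p‖ < r := by
    rw [← hnorm] at hyr
    exact lt_of_mul_lt_mul_right hyr (norm_nonneg _)
  refine hn (mem_circleArc.2 ⟨hpr.trans_le (min_le_left _ _), hpx⟩) ⟨hp0, hpx, y, ?_, ?_, hyN,
    mem_circleArc.2 ⟨hpr.trans_le (min_le_right _ _), hpy⟩⟩
  · rintro rfl
    exact hyc (by simp [crossProd])
  · rintro rfl
    exact hyc (by rw [crossProd]; ring)

end NotIndependentlyBased

/-! ### Failure of strong Fréchetness -/

section NotStronglyFrechet

/-- If `p` lies on the circle around `x`, and on a circle through the origin whose centre `(c, 0)`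
satisfies `1 ≤ c ≤ 2`, then it is the origin or not very close to it. -/
theorem norm_lower_bound {x p : Plane} {c : ℝ} (hc1 : 1 ≤ c) (hc2 : c ≤ 2) (hp0 : p ≠ 0)
    (hpx : p ∈ originCircle x) (hpc : p 0 ^ 2 + p 1 ^ 2 = 2 * (c * p 0)) :
    2 * |x 1| ≤ (|x 1| + (2 + |x 0|)) * ‖p‖ := by
  have hpos : 0 < ‖p‖ := norm_pos_iff.2 hp0
  rw [mem_originCircle] at hpx
  have hsq := plane_norm_sq p
  have hp0nn : 0 ≤ p 0 := by nlinarith [sq_nonneg (p 0), sq_nonneg (p 1)]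
  have hle : 2 * p 0 ≤ ‖p‖ ^ 2 := by nlinarith
  -- The difference of the circle equations bounds `|x 1| * ‖p‖` by a multiple of `p 0` independent
  -- of `c`, while `p 0` is at most `‖p‖ ^ 2 / 2`.
  have h1 : |x 1| * |p 1| ≤ (2 + |x 0|) * p 0 := by
    rw [← abs_mul, show x 1 * p 1 = (c - x 0) * p 0 by linarith, abs_mul, abs_of_nonneg hp0nn]
    refine mul_le_mul_of_nonneg_right ?_ hp0nn
    refine (abs_sub _ _).trans ?_
    rw [abs_of_nonneg (by linarith : (0 : ℝ) ≤ c)]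
    linarith
  have h2 : ‖p‖ ≤ p 0 + |p 1| := by
    rw [← sq_le_sq₀ (norm_nonneg _) (by positivity), hsq]
    nlinarith [sq_abs (p 1), mul_nonneg hp0nn (abs_nonneg (p 1))]
  have h3 : |x 1| * ‖p‖ ≤ (|x 1| + (2 + |x 0|)) * p 0 := by
    nlinarith [mul_le_mul_of_nonneg_left h2 (abs_nonneg (x 1))]
  have h4 : (|x 1| + (2 + |x 0|)) * (2 * p 0) ≤ (|x 1| + (2 + |x 0|)) * ‖p‖ ^ 2 :=
    mul_le_mul_of_nonneg_left hle (by positivity)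
  refine le_of_mul_le_mul_right ?_ hpos
  nlinarith

/-- A sequence of points on the first coordinate axis converging to `(1, 0)`. -/
noncomputable def axisCenter (k : ℕ) : Plane := !₂[1 + 1 / ((k : ℝ) + 1), 0]

theorem axisCenter_zero (k : ℕ) : axisCenter k 0 = 1 + 1 / ((k : ℝ) + 1) := rfl

theorem axisCenter_one (k : ℕ) : axisCenter k 1 = 0 := rfl

theorem one_le_axisCenter (k : ℕ) : 1 ≤ axisCenter k 0 := by
  rw [axisCenter_zero]
  have : (0 : ℝ) ≤ 1 / ((k : ℝ) + 1) := by positivity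
  linarith

theorem axisCenter_le_two (k : ℕ) : axisCenter k 0 ≤ 2 := by
  rw [axisCenter_zero]
  have : 1 / ((k : ℝ) + 1) ≤ 1 := by
    rw [div_le_one (by positivity)]
    linarith [(Nat.cast_nonneg k : (0 : ℝ) ≤ k)]
  linarith

theorem axisCenter_ne_zero (k : ℕ) : axisCenter k ≠ 0 := fun h => by
  have := one_le_axisCenter k
  rw [h] at this
  norm_num at this

theorem axisCenter_injective : Function.Injective axisCenter := fun k l h => by
  have h0 : axisCenter k 0 = axisCenter l 0 := by rw [h]
  rw [axisCenter_zero, axisCenter_zero] at h0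
  have h1 : (1 : ℝ) / ((k : ℝ) + 1) = 1 / ((l : ℝ) + 1) := by linarith
  rw [one_div, one_div, inv_inj] at h1
  exact_mod_cast add_right_cancel h1

/-- Circles through the origin with centres on the first axis are tangent at the origin. -/
theorem eq_of_mem_originCircle_axisCenter {x p : Plane} {k : ℕ} (hx1 : x 1 = 0) (hp0 : p ≠ 0)
    (hpx : p ∈ originCircle x) (hpk : p ∈ originCircle (axisCenter k)) : x = axisCenter k := by
  rw [mem_originCircle] at hpx hpk
  rw [axisCenter_one] at hpk
  have hne : p 0 ≠ 0 := fun h => by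
    rw [h] at hpk
    have hp1 : p 1 ^ 2 = 0 := by linarith
    exact hp0 (plane_ext h (pow_eq_zero_iff two_ne_zero |>.1 hp1))
  refine plane_ext (mul_right_cancel₀ hne ?_) (hx1.trans (axisCenter_one k).symm)
  rw [hx1] at hpx
  linarith

theorem not_isStronglyFrechet_arcTopology : ¬ @IsStronglyFrechet Plane arcTopology := by
  intro h
  let A : ℕ → Set Plane := fun n => {p | p ≠ 0 ∧ ∃ k, n ≤ k ∧ p ∈ originCircle (axisCenter k)}
  have hanti : Antitone A := fun m n hmn p ⟨hp0, k, hk, hp⟩ => ⟨hp0, k, hmn.trans hk, hp⟩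
  obtain ⟨u, hlim, hu⟩ := h 0 A hanti (mem_iInter.2 fun n => by
    rw [@mem_closure_iff_nhds Plane arcTopology, nhds_arcTopology_zero]
    intro s hs
    obtain ⟨m, hm⟩ := hs _ (axisCenter_ne_zero n)
    obtain ⟨p, hp, hp0⟩ := exists_ne_zero_mem_circleArc (axisCenter_ne_zero n) m
    exact ⟨p, hm hp, hp0, n, le_rfl, (mem_circleArc.1 hp).2⟩)
  have hcompl : (range u)ᶜ ∈ arcFilter := by
    intro x hx
    by_cases hx1 : x 1 = 0
    · have hfin : (range u ∩ originCircle x).Finite := by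
        by_cases hk : ∃ k, x = axisCenter k
        · obtain ⟨k, rfl⟩ := hk
          -- Distinct axis circles share only the origin, and `u n` lies on one of index at least
          -- `n`, so `n ≤ k`.
          refine ((finite_Iic k).image u).subset ?_
          rintro _ ⟨⟨n, rfl⟩, hn⟩
          obtain ⟨hp0, l, hl, hp⟩ := hu n
          have := axisCenter_injective (eq_of_mem_originCircle_axisCenter hx1 hp0 hn hp)
          exact mem_image_of_mem u (mem_Iic.2 (this ▸ hl))
        · convert finite_empty
          refine eq_empty_of_forall_notMem ?_
          rintro _ ⟨⟨n, rfl⟩, hn⟩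
          obtain ⟨hp0, l, -, hp⟩ := hu n
          exact hk ⟨l, eq_of_mem_originCircle_axisCenter hx1 hp0 hn hp⟩
      have h0 : (0 : Plane) ∉ range u ∩ originCircle x := by
        rintro ⟨⟨n, hn⟩, -⟩
        exact (hu n).1 hn
      obtain ⟨n, hn⟩ := compl_mem_arcFilter h0 (fun z _ => hfin.inter_of_left _) x hx
      exact ⟨n, fun p hp hpu => hn hp ⟨hpu, (mem_circleArc.1 hp).2⟩⟩
    · have hpos : 0 < |x 1| := abs_pos.2 hx1
      have hM : 0 < |x 1| + (2 + |x 0|) := by positivity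
      obtain ⟨n, hn⟩ := exists_pnat_inv_lt (div_pos (mul_pos two_pos hpos) hM)
      refine ⟨n, ?_⟩
      rintro _ hp ⟨k, rfl⟩
      rw [mem_circleArc] at hp
      obtain ⟨hp0, l, -, hl⟩ := hu k
      rw [mem_originCircle, axisCenter_one] at hl
      have hb := norm_lower_bound (one_le_axisCenter l) (axisCenter_le_two l) hp0 hp.2
        (by linarith)
      have hlt := (lt_div_iff₀ hM).1 (hp.1.trans hn)
      linarith
  rw [nhds_arcTopology_zero] at hlim
  obtain ⟨k, hk⟩ := (hlim.eventually hcompl).exists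
  exact hk (mem_range_self k)

end NotStronglyFrechet

/-- The plane, with all points other than the origin isolated and with the unions of small arcs of
circles through the origin as a neighbourhood base at the origin, is a Fréchet–Urysohn space that is
neither independently-based nor strongly Fréchet. -/
theorem theorem4p9 :
    ∃ t : TopologicalSpace Plane,
      (∀ x : Plane, x ≠ 0 → IsOpen[t] {x}) ∧
      (@nhds Plane t 0).HasBasis (fun _ : Plane → ℕ+ => True) arcUnion ∧
      @FrechetUrysohnSpace Plane t ∧
      ¬ @IsIndependentlyBased.{0, v} Plane t ∧
      ¬ @IsStronglyFrechet Plane t :=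
  ⟨arcTopology, fun _ hx => isOpen_singleton_nhdsAdjoint _ hx, hasBasis_arcTopology,
    frechetUrysohnSpace_arcTopology,
    fun h => by
      obtain ⟨I, 𝒞, hI⟩ := h 0
      exact not_isIndependentNestSystem_arcTopology hI,
    not_isStronglyFrechet_arcTopology⟩
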